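/- Let $\Omega\subset\mathbb R^d$ be nonempty, closed and convex, and let $U:\Omega\to\mathbb R^d$ be continuous and paramonotone, i.e. $\langle U(a)-U(b),a-b\rangle\ge 0$ for all $a,b\in\Omega$, with equality if and only if $U(a)=U(b)$. Assume that the variational inequality of $U$ on $\Omega$ has a solution, where a solution is a point $x_\star\in\Omega$ with $\langle U(x_\star),a-x_\star\rangle\ge 0$ for all $a\in\Omega$. Let $h>2$, $0<s<\tfrac12$, $s<p<1$, $\tfrac{1-p}{2}<q\le 1-p$, and put $$\alpha_0(t)=\frac1{(t+1)^q},\qquad \alpha_1(t)=h+\frac1{(t+1)^s},\qquad \delta(t)=\frac1{(t+1)^p},\qquad \lambda(t)=0 .$$ Let $t_0\ge 0$ and $x_0,x_1\in\Omega$, and let $x:[t_0,\infty)\to\mathbb R^d$ be a strong global solution of $$x''(t)+\alpha_1(t)x'(t)=\delta(t)\left[P_\Omega\!\left(w(t)-\frac{\alpha_0(t)}{\max\{1,\|U(w(t))\|\}}U(w(t))\right)-x(t)\right],\qquad w(t)=x(t)+\lambda(t)x'(t),$$ $$x(t_0)=x_0,\qquad x'(t_0)=\tfrac14\alpha_1(t_0)(x_1-x_0),$$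 where $P_\Omega$ is the metric projection onto $\Omega$. That is, $x$ is differentiable on $[t_0,\infty)$, $x$ and $x'$ are absolutely continuous on every compact interval $[t_0,b]$, the equation holds for almost every $t\ge t_0$, and the initial conditions hold. (It is not assumed that $x(t)\in\Omega$; outside $\Omega$, $U$ in the equation is an arbitrary extension to $\mathbb R^d$.) Then $x(t)$ converges as $t\to\infty$ to a solution of the variational inequality. -/

import Mathlib

open Set Filter Topology MeasureTheory

namespace ParamonotoneVI

/-- `x` solves the variational inequality of `U` on `Ω`. -/
def IsVISolution {d : ℕ} (Ω : Set (EuclideanSpace ℝ (Fin d)))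
    (U : EuclideanSpace ℝ (Fin d) → EuclideanSpace ℝ (Fin d))
    (x : EuclideanSpace ℝ (Fin d)) : Prop :=
  x ∈ Ω ∧ ∀ a ∈ Ω, 0 ≤ inner ℝ (U x) (a - x)

/-- `U` is monotone on `Ω`. -/
def MonotoneOpOn {d : ℕ} (Ω : Set (EuclideanSpace ℝ (Fin d)))
    (U : EuclideanSpace ℝ (Fin d) → EuclideanSpace ℝ (Fin d)) : Prop :=
  ∀ a ∈ Ω, ∀ b ∈ Ω, 0 ≤ inner ℝ (U a - U b) (a - b)

/-- `U` is paramonotone on `Ω`. -/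
def ParamonotoneOpOn {d : ℕ} (Ω : Set (EuclideanSpace ℝ (Fin d)))
    (U : EuclideanSpace ℝ (Fin d) → EuclideanSpace ℝ (Fin d)) : Prop :=
  MonotoneOpOn Ω U ∧
    ∀ a ∈ Ω, ∀ b ∈ Ω, inner ℝ (U a - U b) (a - b) = 0 ↔ U a = U b

/-- The metric projection `P_Ω z`: the point of `Ω` nearest to `z`
(it exists and is unique when `Ω` is nonempty, closed and convex, see below). -/
noncomputable def metricProj {d : ℕ} (Ω : Set (EuclideanSpace ℝ (Fin d)))
    (z : EuclideanSpace ℝ (Fin d)) : EuclideanSpace ℝ (Fin d) :=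
  Classical.epsilon fun p => p ∈ Ω ∧ ∀ w ∈ Ω, ‖z - p‖ ≤ ‖z - w‖

theorem metricProj_spec {d : ℕ} {Ω : Set (EuclideanSpace ℝ (Fin d))}
    (hne : Ω.Nonempty) (hcl : IsClosed Ω) (z : EuclideanSpace ℝ (Fin d)) :
    metricProj Ω z ∈ Ω ∧ ∀ w ∈ Ω, ‖z - metricProj Ω z‖ ≤ ‖z - w‖ := by
  have hex : ∃ p, p ∈ Ω ∧ ∀ w ∈ Ω, ‖z - p‖ ≤ ‖z - w‖ := by
    obtain ⟨p, hp, hpz⟩ := hcl.exists_infDist_eq_dist hne z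
    refine ⟨p, hp, fun w hw => ?_⟩
    rw [← dist_eq_norm, ← dist_eq_norm, ← hpz]
    exact Metric.infDist_le_dist_of_mem hw
  exact Classical.epsilon_spec hex

theorem eq_metricProj {d : ℕ} {Ω : Set (EuclideanSpace ℝ (Fin d))}
    (hcl : IsClosed Ω) (hcv : Convex ℝ Ω) {z p : EuclideanSpace ℝ (Fin d)}
    (hp : p ∈ Ω) (hmin : ∀ w ∈ Ω, ‖z - p‖ ≤ ‖z - w‖) : p = metricProj Ω z := by
  obtain ⟨hq, hqmin⟩ := metricProj_spec ⟨p, hp⟩ hcl z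
  set q := metricProj Ω z
  have hm : (1 / 2 : ℝ) • p + (1 / 2 : ℝ) • q ∈ Ω :=
    hcv hp hq (by norm_num) (by norm_num) (by norm_num)
  have h1 : ‖z - p‖ = ‖z - q‖ := le_antisymm (hmin q hq) (hqmin p hp)
  have h2 := hmin _ hm
  have h3 := parallelogram_law_with_norm ℝ (z - p) (z - q)
  have h4 : (z - p) + (z - q) = (2 : ℝ) • (z - ((1 / 2 : ℝ) • p + (1 / 2 : ℝ) • q)) := by
    module
  have h5 : (z - p) - (z - q) = q - p := by abel
  rw [h4, h5, norm_smul, ← h1] at h3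
  norm_num at h3
  have h6 : ‖q - p‖ = 0 := by
    nlinarith [norm_nonneg (q - p), norm_nonneg (z - p),
      mul_self_le_mul_self (norm_nonneg (z - p)) h2]
  exact (sub_eq_zero.mp (norm_eq_zero.mp h6)).symm

/-- The point `P_Ω (w - (a / max {1, ‖U w‖}) U w)`. -/
noncomputable def projStep {d : ℕ} (Ω : Set (EuclideanSpace ℝ (Fin d)))
    (U : EuclideanSpace ℝ (Fin d) → EuclideanSpace ℝ (Fin d)) (a : ℝ)
    (w : EuclideanSpace ℝ (Fin d)) : EuclideanSpace ℝ (Fin d) :=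
  metricProj Ω (w - (a / max 1 ‖U w‖) • U w)

/-- `f` is locally absolutely continuous on `[t₀, ∞)`. -/
def LocallyACOn {d : ℕ} (f : ℝ → EuclideanSpace ℝ (Fin d)) (t₀ : ℝ) : Prop :=
  ∀ b, t₀ ≤ b → AbsolutelyContinuousOnInterval f t₀ b

/-- The velocity `x'` of a trajectory on `[t₀, ∞)` (one-sided at `t₀`). -/
noncomputable def velocity {d : ℕ} (t₀ : ℝ) (x : ℝ → EuclideanSpace ℝ (Fin d)) :
    ℝ → EuclideanSpace ℝ (Fin d) :=
  derivWithin x (Ici t₀)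

/-- `x` is a strong global solution on `[t₀, ∞)` of
`x'' + α₁ x' = δ (P_Ω (w - (α₀ / max {1, ‖U w‖}) U w) - x)`, with `w = x + lam x'`, and
`x t₀ = x₀`, `x' t₀ = (1/4) α₁(t₀) (x₁ - x₀)`. The trajectory is not assumed to stay in `Ω`. -/
structure IsStrongGlobalSolution {d : ℕ} (Ω : Set (EuclideanSpace ℝ (Fin d)))
    (U : EuclideanSpace ℝ (Fin d) → EuclideanSpace ℝ (Fin d))
    (α₀ α₁ δ lam : ℝ → ℝ) (t₀ : ℝ) (x₀ x₁ : EuclideanSpace ℝ (Fin d))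
    (x : ℝ → EuclideanSpace ℝ (Fin d)) : Prop where
  differentiableOn : DifferentiableOn ℝ x (Ici t₀)
  locallyAC : LocallyACOn x t₀
  locallyAC_velocity : LocallyACOn (velocity t₀ x) t₀
  /-- The second derivative exists and satisfies the equation for almost every `t ≥ t₀`. -/
  equation : ∀ᵐ t ∂(volume : Measure ℝ), t₀ ≤ t →
    ∃ x'' : EuclideanSpace ℝ (Fin d),
      HasDerivWithinAt (velocity t₀ x) x'' (Ici t₀) t ∧
      x'' + α₁ t • velocity t₀ x t =
        δ t • (projStep Ω U (α₀ t) (x t + lam t • velocity t₀ x t) - x t)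
  init : x t₀ = x₀
  init_velocity : velocity t₀ x t₀ = ((1 / 4 : ℝ) * α₁ t₀) • (x₁ - x₀)

end ParamonotoneVI

/-! The damping dominates the restoring force, so a trajectory started with this velocity never
leaves `Ω`: along a separating functional, the distance to the boundary value satisfies an
overdamped inequality and stays positive (`IsStrongGlobalSolution.mem`). On `Ω` the operator is
continuous, so the strong solution is classical.

For a solution `y` of the variational inequality, `lyapunov` dissipates at least `δ α₀ ⟨U x, x - y⟩
/ max 1 ‖U x‖`. The error `2 δ α₀²` is integrable because `p + 2q > 1` and is absorbed by `2 μ`.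
Since `p + q ≤ 1`, the weight `δ α₀` is at least `1 / (t + 1)`, so on the bounded trajectory `⟨U x,
x - y⟩` is arbitrarily small at arbitrarily late times. A limit point along such times solves the
inequality by the cutting property of paramonotone operators.

The distance to every solution has a limit, because `lyapunov` is monotone and the velocity
vanishes. For the limit point just found this limit is zero, as in Opial's argument. -/

namespace ParamonotoneVI

/-! ### Positivity for scalar overdamped inequalities -/

section Scalar

theorem le_of_absolutelyContinuous_of_deriv_nonneg {f : ℝ → ℝ} {a b : ℝ} (hab : a ≤ b)
    (hf : AbsolutelyContinuousOnInterval f a b)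
    (hd : ∀ᵐ t ∂(volume : Measure ℝ), t ∈ Ioo a b → 0 ≤ deriv f t) : f a ≤ f b := by
  have h1 : 0 ≤ ∫ t in a..b, deriv f t := by
    apply intervalIntegral.integral_nonneg_of_ae_restrict hab
    rw [← restrict_Ioo_eq_restrict_Icc]
    exact (ae_restrict_iff' measurableSet_Ioo).2 hd
  rw [hf.integral_deriv_eq_sub] at h1
  linarith

theorem absolutelyContinuousOnInterval_exp_mul (c a b : ℝ) :
    AbsolutelyContinuousOnInterval (fun t => Real.exp (c * t)) a b := by
  apply ContDiffOn.absolutelyContinuousOnInterval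
  fun_prop

/-- Positivity for the overdamped inequality `f'' + (a + β) f' + a β f ≥ 0`, which has to hold
only while `f` and `f' + a f` are nonnegative. -/
theorem pos_of_overdamped {f f' : ℝ → ℝ} {t₀ a β : ℝ}
    (hf : ∀ t, t₀ ≤ t → HasDerivWithinAt f (f' t) (Ici t₀) t)
    (hac : ∀ b, t₀ ≤ b → AbsolutelyContinuousOnInterval f' t₀ b)
    (hacf : ∀ b, t₀ ≤ b → AbsolutelyContinuousOnInterval f t₀ b)
    (h0 : 0 < f t₀) (h0' : 0 < f' t₀ + a * f t₀)
    (hineq : ∀ᵐ t ∂(volume : Measure ℝ), t₀ < t → ∃ f'', HasDerivAt f' f'' t ∧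
      (0 ≤ f t → 0 ≤ f' t + a * f t → 0 ≤ f'' + a * f' t + β * (f' t + a * f t)))
    {t : ℝ} (ht : t₀ ≤ t) : 0 < f t := by
  by_contra hneg
  set g : ℝ → ℝ := fun u => f' u + a * f u with hg
  have hacg : ∀ b, t₀ ≤ b → AbsolutelyContinuousOnInterval g t₀ b := fun b hb =>
    (hac b hb).fun_add ((hacf b hb).const_mul a)
  have hfc : ContinuousOn f (Icc t₀ t) := by
    simpa [uIcc_of_le ht] using (hacf t ht).continuousOn
  have hgc : ContinuousOn g (Icc t₀ t) := by
    simpa [uIcc_of_le ht] using (hacg t ht).continuousOn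
  -- First-exit argument: before `T = sInf S` the functions `e^{a u} f` and `e^{β u} g` are
  -- nondecreasing, so both `f` and `g` are still positive at `T`.
  set S : Set ℝ := Icc t₀ t ∩ (fun u => min (f u) (g u)) ⁻¹' Iic 0 with hS
  have hScl : IsClosed S := (hfc.inf hgc).preimage_isClosed_of_isClosed isClosed_Icc isClosed_Iic
  have hSne : S.Nonempty := ⟨t, ⟨ht, le_rfl⟩, (min_le_left _ _).trans (not_lt.1 hneg)⟩
  have hSbd : BddBelow S := ⟨t₀, fun u hu => hu.1.1⟩
  set T := sInf S
  have hT : T ∈ S := hScl.csInf_mem hSne hSbd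
  have hT0 : t₀ ≤ T := hT.1.1
  have hpos : ∀ u ∈ Ioo t₀ T, 0 < f u ∧ 0 < g u := by
    intro u hu
    by_contra hcon
    have : u ∈ S := by
      refine ⟨⟨hu.1.le, hu.2.le.trans hT.1.2⟩, ?_⟩
      by_contra h3
      exact hcon (lt_min_iff.1 (not_le.1 h3))
    exact absurd (csInf_le hSbd this) (not_le.2 hu.2)
  have hfT : 0 < f T := by
    have h1 := le_of_absolutelyContinuous_of_deriv_nonneg hT0
      ((absolutelyContinuousOnInterval_exp_mul a t₀ T).fun_mul (hacf T hT0)) (by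
        refine ae_of_all _ fun u hu => ?_
        have hd := (hf u hu.1.le).hasDerivAt (Ici_mem_nhds hu.1)
        have he : HasDerivAt (fun u => Real.exp (a * u)) (Real.exp (a * u) * (a * 1)) u :=
          ((hasDerivAt_id u).const_mul a).exp
        rw [(he.fun_mul hd).deriv]
        have := (hpos u hu).2
        have h2 : Real.exp (a * u) * (a * 1) * f u + Real.exp (a * u) * f' u
          = Real.exp (a * u) * g u := by simp only [hg]; ring
        rw [h2]; positivity)
    have h2 : 0 < Real.exp (a * t₀) * f t₀ := by positivity
    exact (pos_iff_pos_of_mul_pos (h2.trans_le h1)).1 (Real.exp_pos _)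
  have hgT : 0 < g T := by
    have h1 := le_of_absolutelyContinuous_of_deriv_nonneg hT0
      ((absolutelyContinuousOnInterval_exp_mul β t₀ T).fun_mul (hacg T hT0)) (by
        filter_upwards [hineq] with u hi hu
        obtain ⟨f'', hf'', hi⟩ := hi hu.1
        have hd := (hf u hu.1.le).hasDerivAt (Ici_mem_nhds hu.1)
        have he : HasDerivAt (fun u => Real.exp (β * u)) (Real.exp (β * u) * (β * 1)) u :=
          ((hasDerivAt_id u).const_mul β).exp
        have hdg : HasDerivAt g (f'' + a * f' u) u := hf''.fun_add (hd.const_mul a)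
        rw [(he.fun_mul hdg).deriv]
        have h3 := hi (hpos u hu).1.le (hpos u hu).2.le
        have h2 : Real.exp (β * u) * (β * 1) * g u + Real.exp (β * u) * (f'' + a * f' u)
          = Real.exp (β * u) * (f'' + a * f' u + β * (f' u + a * f u)) := by
            simp only [hg]; ring
        rw [h2]; positivity)
    have h2 : 0 < Real.exp (β * t₀) * g t₀ := mul_pos (Real.exp_pos _) h0'
    exact (pos_iff_pos_of_mul_pos (h2.trans_le h1)).1 (Real.exp_pos _)
  exact absurd hT.2 (not_le.2 (lt_min hfT hgT))

end Scalar

/-! ### The metric projection and the projected step -/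

section Projection

variable {d : ℕ} {Ω : Set (EuclideanSpace ℝ (Fin d))}

theorem inner_sub_metricProj_le (hne : Ω.Nonempty) (hcl : IsClosed Ω) (hcv : Convex ℝ Ω)
    (z : EuclideanSpace ℝ (Fin d)) {w : EuclideanSpace ℝ (Fin d)} (hw : w ∈ Ω) :
    inner ℝ (z - metricProj Ω z) (w - metricProj Ω z) ≤ 0 := by
  obtain ⟨hm, hmin⟩ := metricProj_spec hne hcl z
  refine (norm_eq_iInf_iff_real_inner_le_zero hcv hm).1 ?_ w hw
  have : Nonempty Ω := ⟨⟨_, hm⟩⟩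
  refine le_antisymm (le_ciInf fun w => hmin w w.2) ?_
  exact ciInf_le (f := fun w : Ω => ‖z - w‖) ⟨0, by rintro _ ⟨w, rfl⟩; positivity⟩ ⟨_, hm⟩

theorem norm_metricProj_sub_le (hne : Ω.Nonempty) (hcl : IsClosed Ω) (hcv : Convex ℝ Ω)
    (a b : EuclideanSpace ℝ (Fin d)) : ‖metricProj Ω a - metricProj Ω b‖ ≤ ‖a - b‖ := by
  have h1 := inner_sub_metricProj_le hne hcl hcv a (metricProj_spec hne hcl b).1
  have h2 := inner_sub_metricProj_le hne hcl hcv b (metricProj_spec hne hcl a).1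
  set u := metricProj Ω a
  set w := metricProj Ω b
  have h3 : ‖u - w‖ ^ 2 ≤ inner ℝ (a - b) (u - w) := by
    rw [← real_inner_self_eq_norm_sq]
    simp only [inner_sub_left, inner_sub_right] at *
    linarith
  have h4 := real_inner_le_norm (a - b) (u - w)
  by_contra h5
  nlinarith [norm_nonneg (u - w), norm_nonneg (a - b)]

theorem metricProj_eq_self (hcl : IsClosed Ω) (hcv : Convex ℝ Ω)
    {a : EuclideanSpace ℝ (Fin d)} (ha : a ∈ Ω) : metricProj Ω a = a :=
  (eq_metricProj hcl hcv ha fun w _ => by simp).symm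

theorem continuous_metricProj (hne : Ω.Nonempty) (hcl : IsClosed Ω) (hcv : Convex ℝ Ω) :
    Continuous (metricProj Ω) :=
  (LipschitzWith.of_dist_le_mul (K := 1) fun a b => by
    simpa [dist_eq_norm] using norm_metricProj_sub_le hne hcl hcv a b).continuous

variable {U : EuclideanSpace ℝ (Fin d) → EuclideanSpace ℝ (Fin d)}

theorem norm_div_max_smul_le {a : ℝ} (ha : 0 ≤ a) (u : EuclideanSpace ℝ (Fin d)) :
    ‖(a / max 1 ‖u‖) • u‖ ≤ a := by
  have h1 : 0 < max 1 ‖u‖ := lt_max_of_lt_left one_pos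
  rw [norm_smul, Real.norm_of_nonneg (by positivity), div_mul_eq_mul_div, div_le_iff₀ h1]
  gcongr
  exact le_max_right _ _

theorem norm_projStep_sub_le (hcl : IsClosed Ω) (hcv : Convex ℝ Ω) {a : ℝ} (ha : 0 ≤ a)
    {w : EuclideanSpace ℝ (Fin d)} (hw : w ∈ Ω) : ‖projStep Ω U a w - w‖ ≤ a := by
  have h1 := norm_metricProj_sub_le ⟨w, hw⟩ hcl hcv (w - (a / max 1 ‖U w‖) • U w) w
  rw [metricProj_eq_self hcl hcv hw] at h1
  refine h1.trans ?_
  rw [sub_sub_cancel_left, norm_neg]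
  exact norm_div_max_smul_le ha _

theorem continuousOn_projStep_comp (hne : Ω.Nonempty) (hcl : IsClosed Ω) (hcv : Convex ℝ Ω)
    (hU : ContinuousOn U Ω) {x : ℝ → EuclideanSpace ℝ (Fin d)} {a : ℝ → ℝ} {s : Set ℝ}
    (hx : ContinuousOn x s) (hxΩ : MapsTo x s Ω) (ha : ContinuousOn a s) :
    ContinuousOn (fun t => projStep Ω U (a t) (x t)) s := by
  have hUx : ContinuousOn (fun t => U (x t)) s := hU.comp hx hxΩ
  refine (continuous_metricProj hne hcl hcv).comp_continuousOn (hx.sub (ContinuousOn.fun_smul ?_ hUx))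
  exact ha.div (continuousOn_const.sup hUx.norm) fun t _ =>
    (lt_max_of_lt_left one_pos).ne'

end Projection

/-! ### From almost everywhere to everywhere differentiability -/

section Regularity

variable {E : Type*} [NormedAddCommGroup E] [NormedSpace ℝ E] [CompleteSpace E]

/-- The difference between `v` and the integral of `g` is absolutely continuous with derivative zero
almost everywhere, hence constant. -/
theorem hasDerivAt_of_ae_of_continuousOn {v g : ℝ → E} {t₀ : ℝ}
    (hv : ∀ b, t₀ ≤ b → AbsolutelyContinuousOnInterval v t₀ b) (hg : ContinuousOn g (Ici t₀))
    (hd : ∀ᵐ t ∂(volume : Measure ℝ), t₀ < t → HasDerivAt v (g t) t) {t : ℝ} (ht : t₀ < t) :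
    HasDerivAt v (g t) t := by
  -- Clamping at `t₀` makes the integrand continuous on the whole line.
  set G : ℝ → E := fun u => g (max t₀ u) with hG
  have hGc : Continuous G := hg.comp_continuous (by fun_prop) fun u => mem_Ici.2 (le_max_left _ _)
  have hGg : ∀ u, t₀ ≤ u → G u = g u := fun u hu => by simp [hG, hu]
  set I : ℝ → E := fun u => ∫ r in t₀..u, G r with hI
  have hId : ∀ u, HasDerivAt I (G u) u := fun u => hGc.integral_hasStrictDerivAt t₀ u |>.hasDerivAt
  have hIac : AbsolutelyContinuousOnInterval I t₀ (t + 1) := by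
    apply ContDiffOn.absolutelyContinuousOnInterval
    apply ContDiff.contDiffOn
    rw [contDiff_one_iff_deriv]
    refine ⟨fun u => (hId u).differentiableAt, ?_⟩
    rwa [funext fun u => (hId u).deriv]
  obtain ⟨C, hC⟩ := ((hv (t + 1) (by linarith)).fun_sub hIac).const_of_ae_hasDerivAt_zero (by
    filter_upwards [hd, Measure.ae_ne volume t₀] with u hu hne hmem
    rw [uIcc_of_le (by linarith)] at hmem
    have h1 := (hu (lt_of_le_of_ne hmem.1 hne.symm)).fun_sub (hId u)
    rwa [hGg u hmem.1, sub_self] at h1)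
  rw [uIcc_of_le (by linarith)] at hC
  have h2 : v =ᶠ[𝓝 t] fun u => C + I u := by
    filter_upwards [Icc_mem_nhds ht (lt_add_one t)] with u hu
    rw [← hC u hu]; abel
  rw [← hGg t ht.le]
  exact ((hId t).const_add C).congr_of_eventuallyEq h2

end Regularity

/-! ### Invariance of `Ω` -/

section Invariance

theorem absolutelyContinuousOnInterval_clm_comp {E : Type*} [NormedAddCommGroup E]
    [NormedSpace ℝ E] (ξ : StrongDual ℝ E) {f : ℝ → E} {a b : ℝ}
    (hf : AbsolutelyContinuousOnInterval f a b) :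
    AbsolutelyContinuousOnInterval (fun t => ξ (f t)) a b := by
  refine squeeze_zero (fun t => Finset.sum_nonneg fun i _ => dist_nonneg) (fun t => ?_)
    (by simpa using Filter.Tendsto.const_mul ‖ξ‖ hf)
  rw [Finset.mul_sum]
  gcongr with i
  simpa [dist_eq_norm] using ξ.le_opNorm (f (t.2 i).1 - f (t.2 i).2)

variable {d : ℕ} {Ω : Set (EuclideanSpace ℝ (Fin d))}
  {U : EuclideanSpace ℝ (Fin d) → EuclideanSpace ℝ (Fin d)} {α₀ α₁ δ : ℝ → ℝ} {t₀ : ℝ}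
  {x₀ x₁ : EuclideanSpace ℝ (Fin d)} {x : ℝ → EuclideanSpace ℝ (Fin d)}

/-- Trajectories starting in `Ω` stay in `Ω` when the damping is large enough. -/
theorem IsStrongGlobalSolution.mem (hΩcl : IsClosed Ω) (hΩcv : Convex ℝ Ω)
    (hx₀ : x₀ ∈ Ω) (hx₁ : x₁ ∈ Ω)
    (hx : IsStrongGlobalSolution Ω U α₀ α₁ δ (fun _ => 0) t₀ x₀ x₁ x) {a β : ℝ}
    (hβ : ∀ t, t₀ ≤ t → α₁ t - a ≤ β) (hδ : ∀ t, t₀ ≤ t → 0 ≤ δ t)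
    (hover : ∀ t, t₀ ≤ t → δ t ≤ a * (α₁ t - a)) (hpos : 0 < α₁ t₀) (hα : α₁ t₀ ≤ 4 * a)
    {t : ℝ} (ht : t₀ ≤ t) : x t ∈ Ω := by
  by_contra hnot
  obtain ⟨ξ, c, hξ, hc⟩ := geometric_hahn_banach_closed_point hΩcv hΩcl hnot
  have hdx : ∀ u, t₀ ≤ u → HasDerivWithinAt x (velocity t₀ x u) (Ici t₀) u := fun u hu =>
    (hx.differentiableOn u hu).hasDerivWithinAt
  have hconst : ∀ b, AbsolutelyContinuousOnInterval (fun _ : ℝ => c) t₀ b := fun b =>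
    contDiffOn_const.absolutelyContinuousOnInterval
  have hprojmem : ∀ a w, projStep Ω U a w ∈ Ω := fun a w => (metricProj_spec ⟨x₀, hx₀⟩ hΩcl _).1
  have key := pos_of_overdamped (f := fun u => c - ξ (x u)) (f' := fun u => -ξ (velocity t₀ x u))
    (t₀ := t₀) (a := a) (β := β)
    (fun u hu => (ξ.hasFDerivAt.comp_hasDerivWithinAt u (hdx u hu)).const_sub c)
    (fun b hb => (absolutelyContinuousOnInterval_clm_comp ξ (hx.locallyAC_velocity b hb)).fun_neg)
    (fun b hb => (hconst b).fun_sub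
      (absolutelyContinuousOnInterval_clm_comp ξ (hx.locallyAC b hb)))
    (by simpa [hx.init] using hξ x₀ hx₀)
    (by
      -- The quantity equals `(α₁/4)(c - ξ x₁) + (a - α₁/4)(c - ξ x₀)` at `t₀`; this is where `α₁ t₀
      -- ≤ 4a` enters.
      simp only [hx.init, hx.init_velocity, map_smul, map_sub, smul_eq_mul]
      have h0 := hξ x₀ hx₀
      have h1 := mul_pos hpos (sub_pos.2 (hξ x₁ hx₁))
      nlinarith)
    (by
      filter_upwards [hx.equation] with u hu hlt
      obtain ⟨x'', hx'', heq⟩ := hu hlt.le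
      refine ⟨-ξ x'', (ξ.hasFDerivAt.comp_hasDerivAt u
        (hx''.hasDerivAt (Ici_mem_nhds hlt))).fun_neg, fun hf hg => ?_⟩
      have h1 := congrArg ξ heq
      simp only [map_add, map_smul, map_sub, smul_eq_mul] at h1
      set z := projStep Ω U (α₀ u) (x u + (0 : ℝ) • velocity t₀ x u)
      -- With `f = c - ξ x` and `g = f' + a f`, the target is `δ (c - ξ z) + (a (α₁ - a) - δ) f + (β
      -- - (α₁ - a)) g`, a sum of nonnegative terms.
      have h2 := mul_nonneg (hδ u hlt.le) (sub_pos.2 (hξ z (hprojmem _ _))).le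
      have h3 := mul_nonneg (sub_nonneg.2 (hover u hlt.le)) hf
      have h4 := mul_nonneg (sub_nonneg.2 (hβ u hlt.le)) hg
      linarith)
    ht
  linarith

end Invariance

/-! ### Inner product estimates for the dissipation -/

section Algebra

variable {E : Type*} [NormedAddCommGroup E] [InnerProductSpace ℝ E]

/-- For `z` the projection of `x - u`, expanding the obtuse-angle inequality leaves `⟨u, z - x⟩` as
the only error, and Cauchy–Schwarz bounds it by `a²`. -/
theorem inner_step_le {x y z u : E} {a : ℝ} (hu : ‖u‖ ≤ a) (hzx : ‖z - x‖ ≤ a)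
    (hproj : inner ℝ (x - u - z) (y - z) ≤ 0) :
    inner ℝ (x - y) (z - x) ≤ a ^ 2 - inner ℝ u (x - y) := by
  have h1 : inner ℝ (x - u - z) (y - z)
      = inner ℝ (x - y) (z - x) + ‖z - x‖ ^ 2 + inner ℝ u (x - y) + inner ℝ u (z - x) := by
    rw [← real_inner_self_eq_norm_sq]
    simp only [inner_sub_left, inner_sub_right]
    rw [real_inner_comm x y, real_inner_comm x z, real_inner_comm y z]
    ring
  have h2 := neg_le_of_abs_le (abs_real_inner_le_norm u (z - x))
  have h3 : ‖u‖ * ‖z - x‖ ≤ a * a := by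
    gcongr
    exact (norm_nonneg u).trans hu
  nlinarith [sq_nonneg ‖z - x‖]

theorem inner_damped_le {v w : E} {α ρ : ℝ} (hα : 2 ≤ α) (hw : ‖w‖ ≤ ρ) :
    ‖v‖ ^ 2 + inner ℝ v (-(α • v) + w) ≤ ρ ^ 2 := by
  have h1 := real_inner_le_norm v w
  have h2 : ‖v‖ * ‖w‖ ≤ ‖v‖ * ρ := by gcongr
  rw [inner_add_right, inner_neg_right, real_inner_smul_right, real_inner_self_eq_norm_sq]
  nlinarith [mul_nonneg (sub_nonneg.2 hα) (sq_nonneg ‖v‖), sq_nonneg (‖v‖ - ρ / 2), sq_nonneg ρ]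

/-- The terms `α ⟨x - y, v⟩` cancel. One `δ a²` comes from `inner_step_le`, the other from
`inner_damped_le` through `(δ a)² ≤ δ a²`. -/
theorem lyapunov_deriv_le {x y v z u : E} {α δ a : ℝ} (hα : 2 ≤ α) (hδ0 : 0 ≤ δ) (hδ1 : δ ≤ 1)
    (hu : ‖u‖ ≤ a) (hzx : ‖z - x‖ ≤ a) (hproj : inner ℝ (x - u - z) (y - z) ≤ 0) :
    ‖v‖ ^ 2 + inner ℝ (x - y) (-(α • v) + δ • (z - x)) + α * inner ℝ (x - y) v
      + inner ℝ v (-(α • v) + δ • (z - x)) ≤ 2 * (δ * a ^ 2) - δ * inner ℝ u (x - y) := by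
  have h1 := mul_le_mul_of_nonneg_left (inner_step_le hu hzx hproj) hδ0
  have hw : ‖δ • (z - x)‖ ≤ δ * a := by
    rw [norm_smul, Real.norm_of_nonneg hδ0]; gcongr
  have h2 := inner_damped_le (v := v) hα hw
  have h3 : inner ℝ (x - y) (-(α • v) + δ • (z - x))
      = -(α * inner ℝ (x - y) v) + δ * inner ℝ (x - y) (z - x) := by
    rw [inner_add_right, inner_neg_right, real_inner_smul_right, real_inner_smul_right]
  have h4 : (δ * a) ^ 2 ≤ δ * a ^ 2 := by
    have := mul_nonneg (mul_nonneg hδ0 (sub_nonneg.2 hδ1)) (sq_nonneg a)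
    nlinarith
  linarith

end Algebra

/-! ### Asymptotics of scalar differential inequalities -/

section Limits

theorem antitoneOn_Ioi_of_hasDerivAt {f f' : ℝ → ℝ} {t₀ : ℝ}
    (hf : ∀ t, t₀ < t → HasDerivAt f (f' t) t) (hf' : ∀ t, t₀ < t → f' t ≤ 0) :
    AntitoneOn f (Ioi t₀) := by
  refine antitoneOn_of_hasDerivWithinAt_nonpos (f' := f') (convex_Ioi t₀)
    (fun t ht => (hf t ht).continuousAt.continuousWithinAt) ?_ ?_
  · intro t ht
    rw [interior_Ioi] at ht
    exact (hf t ht).hasDerivWithinAt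
  · intro t ht
    rw [interior_Ioi] at ht
    exact hf' t ht

theorem exists_tendsto_of_antitoneOn_Ioi {f : ℝ → ℝ} {t₀ : ℝ} (hf : AntitoneOn f (Ioi t₀))
    (h0 : ∀ t, t₀ < t → 0 ≤ f t) : ∃ l, Tendsto f atTop (𝓝 l) := by
  have hanti : Antitone fun t => f (max (t₀ + 1) t) := fun a b hab =>
    hf (lt_max_of_lt_left (lt_add_one t₀)) (lt_max_of_lt_left (lt_add_one t₀))
      (max_le_max le_rfl hab)
  have hb : BddBelow (range fun t => f (max (t₀ + 1) t)) :=
    ⟨0, by rintro _ ⟨t, rfl⟩; exact h0 _ (lt_max_of_lt_left (lt_add_one t₀))⟩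
  refine ⟨_, (tendsto_atTop_ciInf hanti hb).congr' ?_⟩
  filter_upwards [eventually_ge_atTop (t₀ + 1)] with t ht
  simp [ht]

/-- A nonnegative quantity with `f' ≤ -c f + ρ`, `ρ → 0`, tends to zero. -/
theorem tendsto_zero_of_deriv_le {f f' ρ : ℝ → ℝ} {t₀ c : ℝ} (hc : 0 < c)
    (hf : ∀ t, t₀ < t → HasDerivAt f (f' t) t) (h0 : ∀ t, t₀ < t → 0 ≤ f t)
    (hf' : ∀ t, t₀ < t → f' t ≤ -c * f t + ρ t) (hρ : Tendsto ρ atTop (𝓝 0)) :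
    Tendsto f atTop (𝓝 0) := by
  rw [tendsto_order]
  refine ⟨fun b hb => ?_, fun ε hε => ?_⟩
  · filter_upwards [eventually_gt_atTop t₀] with t ht using hb.trans_le (h0 t ht)
  · obtain ⟨T, hT⟩ := eventually_atTop.1 (hρ.eventually_lt_const (mul_pos hc (half_pos hε)))
    set T₁ := max T t₀
    -- Once `ρ < c ε / 2`, the excess `f - ε / 2` decays at least like `e^{-ct}`.
    have hanti : AntitoneOn (fun t => Real.exp (c * t) * (f t - ε / 2)) (Ioi T₁) := by
      refine antitoneOn_Ioi_of_hasDerivAt (fun t ht =>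
        ((hasDerivAt_id t).const_mul c).exp.fun_mul
          ((hf t ((le_max_right _ _).trans_lt ht)).sub_const (ε / 2))) fun t ht => ?_
      have h1 := hf' t ((le_max_right _ _).trans_lt ht)
      have h2 := hT t ((le_max_left _ _).trans ht.le)
      have h3 : f' t + c * (f t - ε / 2) ≤ 0 := by linarith
      have h4 := mul_nonpos_of_nonneg_of_nonpos (Real.exp_pos (c * t)).le h3
      simp only [id]
      linarith
    set C := Real.exp (c * (T₁ + 1)) * (f (T₁ + 1) - ε / 2)
    have hlim : Tendsto (fun t => C * Real.exp (-(c * t))) atTop (𝓝 0) := by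
      have := (Real.tendsto_exp_neg_atTop_nhds_zero.comp
        (tendsto_id.const_mul_atTop hc)).const_mul C
      simpa using this
    filter_upwards [hlim.eventually_lt_const (half_pos hε), eventually_ge_atTop (T₁ + 1)]
      with t h1 h2
    have h3 := hanti (mem_Ioi.2 (lt_add_one T₁)) (mem_Ioi.2 (by linarith)) h2
    have h4 := mul_le_mul_of_nonneg_right h3 (Real.exp_pos (-(c * t))).le
    have h5 : Real.exp (c * t) * Real.exp (-(c * t)) = 1 := by
      rw [← Real.exp_add]; simp
    have h6 : f t - ε / 2 = Real.exp (c * t) * (f t - ε / 2) * Real.exp (-(c * t)) := by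
      linear_combination (-(f t - ε / 2)) * h5
    have h7 : f t - ε / 2 ≤ C * Real.exp (-(c * t)) := h6 ▸ h4
    linarith

/-- If `f ≥ 0` decreases at rate at least `c w / (t + 1)`, then `w` is frequently small. -/
theorem frequently_lt_of_deriv_le {f f' w : ℝ → ℝ} {t₀ c : ℝ} (ht₀ : 0 ≤ t₀) (hc : 0 < c)
    (hf : ∀ t, t₀ < t → HasDerivAt f (f' t) t) (h0 : ∀ t, t₀ < t → 0 ≤ f t)
    (hf' : ∀ t, t₀ < t → f' t ≤ -(c * w t / (t + 1))) {ε : ℝ} (hε : 0 < ε) :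
    ∃ᶠ t in atTop, w t < ε := by
  intro hcon
  obtain ⟨T, hT⟩ := eventually_atTop.1 hcon
  set T₁ := max T t₀
  -- If `w ≥ ε` from some time on, `f` falls at least as fast as `c ε log (t + 1)` grows,
  -- contradicting `f ≥ 0`.
  have hanti : AntitoneOn (fun t => f t + c * ε * Real.log (t + 1)) (Ioi T₁) := by
    have hT₁ : ∀ t, T₁ < t → T ≤ t ∧ t₀ < t := fun t ht =>
      ⟨(le_max_left _ _).trans ht.le, (le_max_right _ _).trans_lt ht⟩
    refine antitoneOn_Ioi_of_hasDerivAt (fun t ht => (hf t (hT₁ t ht).2).fun_add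
      ((((hasDerivAt_id t).add_const 1).log (by have := (hT₁ t ht).2; simp; linarith)).const_mul
        (c * ε))) fun t ht => ?_
    obtain ⟨h1, h2⟩ := hT₁ t ht
    have h3 := not_lt.1 (hT t h1)
    have h4 : 0 < t + 1 := by linarith
    have h5 : c * ε / (t + 1) ≤ c * w t / (t + 1) := by gcongr
    have h6 := hf' t h2
    simp only [id, mul_one_div]
    linarith
  have hlog : Tendsto (fun t : ℝ => c * ε * Real.log (t + 1)) atTop atTop :=
    (Real.tendsto_log_atTop.comp (tendsto_atTop_add_const_right _ 1 tendsto_id)).const_mul_atTop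
      (mul_pos hc hε)
  obtain ⟨t, h1, h2⟩ := ((hlog.eventually_gt_atTop
    (f (T₁ + 1) + c * ε * Real.log (T₁ + 1 + 1))).and (eventually_ge_atTop (T₁ + 1))).exists
  have h3 := hanti (mem_Ioi.2 (lt_add_one T₁)) (mem_Ioi.2 (by linarith)) h2
  have h4 := h0 t ((le_max_right T t₀).trans_lt (by linarith))
  simp only at h3
  linarith

end Limits

/-! ### Lyapunov analysis and convergence to a solution -/

section Convergence

variable {d : ℕ} {Ω : Set (EuclideanSpace ℝ (Fin d))}
  {U : EuclideanSpace ℝ (Fin d) → EuclideanSpace ℝ (Fin d)}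

theorem IsVISolution.inner_nonneg (hmono : MonotoneOpOn Ω U) {x y : EuclideanSpace ℝ (Fin d)}
    (hy : IsVISolution Ω U y) (hx : x ∈ Ω) : 0 ≤ inner ℝ (U x) (x - y) := by
  have h1 := hmono x hx y hy.1
  have h2 := hy.2 x hx
  rw [inner_sub_left] at h1
  linarith

/-- The cutting property of paramonotone operators. -/
theorem IsVISolution.of_inner_nonpos (hpara : ParamonotoneOpOn Ω U)
    {x y : EuclideanSpace ℝ (Fin d)} (hy : IsVISolution Ω U y) (hx : x ∈ Ω)
    (h : inner ℝ (U x) (x - y) ≤ 0) : IsVISolution Ω U x := by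
  have h1 := hpara.1 x hx y hy.1
  have h2 := hy.2 x hx
  have h3 : inner ℝ (U x - U y) (x - y) = inner ℝ (U x) (x - y) - inner ℝ (U y) (x - y) :=
    inner_sub_left _ _ _
  -- Monotonicity and the two sign conditions squeeze `⟨U x - U y, x - y⟩` to zero.
  have hU : U x = U y := (hpara.2 x hx y hy.1).1 (by linarith)
  refine ⟨hx, fun a ha => ?_⟩
  have h4 := hy.2 a ha
  rw [hU] at h ⊢
  have h5 : a - x = (a - y) - (x - y) := by abel
  rw [h5, inner_sub_right]
  linarith

/-- The properties of the coefficients behind the convergence: `α₁` decreases to `h`, the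
function `μ` is an antiderivative of `-δ α₀²`, and `δ α₀` tends to zero no faster than
`1 / (t + 1)`. -/
structure AdmissibleCoefficients (α₀ α₁ δ α₁' μ : ℝ → ℝ) (h t₀ : ℝ) : Prop where
  t₀_nonneg : 0 ≤ t₀
  two_le : 2 ≤ h
  le_damping : ∀ t, t₀ < t → h ≤ α₁ t
  hasDerivAt_damping : ∀ t, t₀ < t → HasDerivAt α₁ (α₁' t) t
  deriv_damping_nonpos : ∀ t, t₀ < t → α₁' t ≤ 0
  tendsto_damping : Tendsto α₁ atTop (𝓝 h)
  delta_nonneg : ∀ t, t₀ < t → 0 ≤ δ t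
  delta_le_one : ∀ t, t₀ < t → δ t ≤ 1
  step_nonneg : ∀ t, t₀ < t → 0 ≤ α₀ t
  hasDerivAt_mu : ∀ t, t₀ < t → HasDerivAt μ (-(δ t * α₀ t ^ 2)) t
  mu_nonneg : ∀ t, t₀ < t → 0 ≤ μ t
  le_delta_mul_step : ∀ t, t₀ < t → 1 / (t + 1) ≤ δ t * α₀ t
  tendsto_delta_mul_step : Tendsto (fun t => δ t * α₀ t) atTop (𝓝 0)

/-- A classical solution of the equation on `(t₀, ∞)` with values in `Ω`. -/
structure IsClassicalTrajectory (Ω : Set (EuclideanSpace ℝ (Fin d)))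
    (U : EuclideanSpace ℝ (Fin d) → EuclideanSpace ℝ (Fin d)) (α₀ α₁ δ : ℝ → ℝ) (t₀ : ℝ)
    (x v : ℝ → EuclideanSpace ℝ (Fin d)) : Prop where
  mem : ∀ t, t₀ < t → x t ∈ Ω
  hasDerivAt_pos : ∀ t, t₀ < t → HasDerivAt x (v t) t
  hasDerivAt_vel : ∀ t, t₀ < t →
    HasDerivAt v (-(α₁ t • v t) + δ t • (projStep Ω U (α₀ t) (x t) - x t)) t

/-- The Lyapunov function of a trajectory with respect to the point `y`. -/
noncomputable def lyapunov (α₁ μ : ℝ → ℝ) (x v : ℝ → EuclideanSpace ℝ (Fin d))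
    (y : EuclideanSpace ℝ (Fin d)) (t : ℝ) : ℝ :=
  inner ℝ (x t - y) (v t) + α₁ t * (‖x t - y‖ ^ 2 / 2) + ‖v t‖ ^ 2 / 2 + 2 * μ t

variable {α₀ α₁ δ α₁' μ : ℝ → ℝ} {h t₀ : ℝ} {x v : ℝ → EuclideanSpace ℝ (Fin d)}

/-- As `α₁ ≥ 2`, half of the potential term, together with `‖v‖² / 2`, compensates the cross term by
Young's inequality. -/
theorem norm_sq_le_lyapunov (hc : AdmissibleCoefficients α₀ α₁ δ α₁' μ h t₀)
    (y : EuclideanSpace ℝ (Fin d)) {t : ℝ} (ht : t₀ < t) :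
    ‖x t - y‖ ^ 2 / 2 ≤ lyapunov α₁ μ x v y t := by
  have h1 := neg_le_of_abs_le (abs_real_inner_le_norm (x t - y) (v t))
  have h2 := mul_nonneg (sub_nonneg.2 (hc.two_le.trans (hc.le_damping t ht)))
    (sq_nonneg ‖x t - y‖)
  have h3 := hc.mu_nonneg t ht
  unfold lyapunov
  nlinarith [sq_nonneg (‖x t - y‖ - ‖v t‖)]

theorem lyapunov_nonneg (hc : AdmissibleCoefficients α₀ α₁ δ α₁' μ h t₀)
    (y : EuclideanSpace ℝ (Fin d)) {t : ℝ} (ht : t₀ < t) : 0 ≤ lyapunov α₁ μ x v y t :=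
  le_trans (by positivity) (norm_sq_le_lyapunov hc y ht)

theorem exists_hasDerivAt_lyapunov (hΩcl : IsClosed Ω) (hΩcv : Convex ℝ Ω)
    (hc : AdmissibleCoefficients α₀ α₁ δ α₁' μ h t₀)
    (hx : IsClassicalTrajectory Ω U α₀ α₁ δ t₀ x v) {y : EuclideanSpace ℝ (Fin d)} (hy : y ∈ Ω) :
    ∃ L' : ℝ → ℝ, ∀ t, t₀ < t → HasDerivAt (lyapunov α₁ μ x v y) (L' t) t ∧
      L' t ≤ -(δ t * (α₀ t / max 1 ‖U (x t)‖ * inner ℝ (U (x t)) (x t - y))) := by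
  -- The witness `L'` is read off by unification from the derivative rules.
  refine ⟨fun t => _, fun t ht => ⟨((((hx.hasDerivAt_pos t ht).sub_const y).inner ℝ
    (hx.hasDerivAt_vel t ht)).fun_add ((hc.hasDerivAt_damping t ht).fun_mul
    (((hx.hasDerivAt_pos t ht).sub_const y).norm_sq.div_const 2))).fun_add
    ((hx.hasDerivAt_vel t ht).norm_sq.div_const 2) |>.fun_add
    ((hc.hasDerivAt_mu t ht).const_mul 2), ?_⟩⟩
  have hxt := hx.mem t ht
  have h1 := lyapunov_deriv_le (v := v t) (hc.two_le.trans (hc.le_damping t ht))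
    (hc.delta_nonneg t ht) (hc.delta_le_one t ht)
    (norm_div_max_smul_le (hc.step_nonneg t ht) (U (x t)))
    (norm_projStep_sub_le (U := U) hΩcl hΩcv (hc.step_nonneg t ht) hxt)
    (inner_sub_metricProj_le ⟨y, hy⟩ hΩcl hΩcv (x t - (α₀ t / max 1 ‖U (x t)‖) • U (x t)) hy)
  have h2 := mul_nonpos_of_nonpos_of_nonneg (hc.deriv_damping_nonpos t ht)
    (sq_nonneg ‖x t - y‖)
  rw [real_inner_smul_left] at h1
  beta_reduce
  rw [real_inner_self_eq_norm_sq]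
  linarith

theorem tendsto_velocity_zero (hΩcl : IsClosed Ω) (hΩcv : Convex ℝ Ω)
    (hc : AdmissibleCoefficients α₀ α₁ δ α₁' μ h t₀)
    (hx : IsClassicalTrajectory Ω U α₀ α₁ δ t₀ x v) :
    Tendsto (fun t => ‖v t‖ ^ 2 / 2) atTop (𝓝 0) := by
  refine tendsto_zero_of_deriv_le (c := 2) two_pos
    (fun t ht => (hx.hasDerivAt_vel t ht).norm_sq.div_const 2) (fun t _ => by positivity)
    (ρ := fun t => (δ t * α₀ t) ^ 2) (fun t ht => ?_)
    (by simpa using hc.tendsto_delta_mul_step.pow 2)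
  have hw : ‖δ t • (projStep Ω U (α₀ t) (x t) - x t)‖ ≤ δ t * α₀ t := by
    rw [norm_smul, Real.norm_of_nonneg (hc.delta_nonneg t ht)]
    exact mul_le_mul_of_nonneg_left
      (norm_projStep_sub_le hΩcl hΩcv (hc.step_nonneg t ht) (hx.mem t ht)) (hc.delta_nonneg t ht)
  have := inner_damped_le (v := v t) (hc.two_le.trans (hc.le_damping t ht)) hw
  linarith

theorem antitoneOn_lyapunov (hΩcl : IsClosed Ω) (hΩcv : Convex ℝ Ω) (hmono : MonotoneOpOn Ω U)
    (hc : AdmissibleCoefficients α₀ α₁ δ α₁' μ h t₀)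
    (hx : IsClassicalTrajectory Ω U α₀ α₁ δ t₀ x v) {y : EuclideanSpace ℝ (Fin d)}
    (hy : IsVISolution Ω U y) : AntitoneOn (lyapunov α₁ μ x v y) (Ioi t₀) := by
  obtain ⟨L', hL⟩ := exists_hasDerivAt_lyapunov hΩcl hΩcv hc hx hy.1
  refine antitoneOn_Ioi_of_hasDerivAt (fun t ht => (hL t ht).1) fun t ht => (hL t ht).2.trans ?_
  have h1 := hy.inner_nonneg hmono (hx.mem t ht)
  have h2 := hc.delta_nonneg t ht
  have h3 := hc.step_nonneg t ht
  have h4 : 0 < max 1 ‖U (x t)‖ := lt_max_of_lt_left one_pos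
  rw [neg_nonpos]
  positivity

theorem exists_norm_sub_le (hΩcl : IsClosed Ω) (hΩcv : Convex ℝ Ω) (hmono : MonotoneOpOn Ω U)
    (hc : AdmissibleCoefficients α₀ α₁ δ α₁' μ h t₀)
    (hx : IsClassicalTrajectory Ω U α₀ α₁ δ t₀ x v) {y : EuclideanSpace ℝ (Fin d)}
    (hy : IsVISolution Ω U y) : ∃ K, ∀ t, t₀ + 1 < t → ‖x t - y‖ ≤ K := by
  -- Monotonicity is known only on the open ray, so the reference time is `t₀ + 1`.
  refine ⟨√(2 * lyapunov α₁ μ x v y (t₀ + 1)), fun t ht => Real.le_sqrt_of_sq_le ?_⟩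
  have h1 := antitoneOn_lyapunov hΩcl hΩcv hmono hc hx hy (mem_Ioi.2 (lt_add_one t₀))
    (mem_Ioi.2 (by linarith)) ht.le
  have h2 := norm_sq_le_lyapunov (x := x) (v := v) hc y (by linarith : t₀ < t)
  linarith

theorem exists_tendsto_norm_sub_sq (hΩcl : IsClosed Ω) (hΩcv : Convex ℝ Ω)
    (hmono : MonotoneOpOn Ω U) (hc : AdmissibleCoefficients α₀ α₁ δ α₁' μ h t₀)
    (hx : IsClassicalTrajectory Ω U α₀ α₁ δ t₀ x v) {y : EuclideanSpace ℝ (Fin d)}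
    (hy : IsVISolution Ω U y) : ∃ l, Tendsto (fun t => ‖x t - y‖ ^ 2) atTop (𝓝 l) := by
  obtain ⟨l, hl⟩ := exists_tendsto_of_antitoneOn_Ioi
    (antitoneOn_lyapunov hΩcl hΩcv hmono hc hx hy) fun t ht => lyapunov_nonneg hc y ht
  obtain ⟨m, hm⟩ := exists_tendsto_of_antitoneOn_Ioi
    (antitoneOn_Ioi_of_hasDerivAt hc.hasDerivAt_mu fun t ht =>
      neg_nonpos.2 (mul_nonneg (hc.delta_nonneg t ht) (sq_nonneg _))) hc.mu_nonneg
  obtain ⟨K, hK⟩ := exists_norm_sub_le hΩcl hΩcv hmono hc hx hy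
  have hv := tendsto_velocity_zero hΩcl hΩcv hc hx
  have hv' : Tendsto (fun t => ‖v t‖) atTop (𝓝 0) := by
    have := (hv.const_mul 2).sqrt
    simpa [mul_div_cancel₀] using this
  have hin : Tendsto (fun t => inner ℝ (x t - y) (v t)) atTop (𝓝 0) := by
    refine squeeze_zero_norm' ?_ (by simpa using hv'.const_mul K)
    filter_upwards [eventually_gt_atTop (t₀ + 1)] with t ht
    exact (norm_inner_le_norm _ _).trans (by gcongr; exact hK t ht)
  -- Every other term of `lyapunov` converges and `α₁ → h ≠ 0`, so the squared distance can be
  -- solved for.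
  have hlim := ((((hl.sub hin).sub hv).sub (hm.const_mul 2)).div hc.tendsto_damping
    (by linarith [hc.two_le])).const_mul 2
  refine ⟨_, hlim.congr' ?_⟩
  filter_upwards [eventually_gt_atTop t₀] with t ht
  have h1 : α₁ t ≠ 0 := by linarith [hc.two_le, hc.le_damping t ht]
  simp only [lyapunov, Pi.div_apply]
  field_simp
  ring

/-- Trajectories approach a solution along a sequence of times. -/
theorem exists_subseq_tendsto_solution (hΩcl : IsClosed Ω) (hΩcv : Convex ℝ Ω)
    (hpara : ParamonotoneOpOn Ω U) (hU : ContinuousOn U Ω)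
    (hc : AdmissibleCoefficients α₀ α₁ δ α₁' μ h t₀)
    (hx : IsClassicalTrajectory Ω U α₀ α₁ δ t₀ x v) {y : EuclideanSpace ℝ (Fin d)}
    (hy : IsVISolution Ω U y) :
    ∃ (z : EuclideanSpace ℝ (Fin d)) (τ : ℕ → ℝ), IsVISolution Ω U z ∧
      Tendsto τ atTop atTop ∧ Tendsto (x ∘ τ) atTop (𝓝 z) := by
  obtain ⟨K, hK⟩ := exists_norm_sub_le hΩcl hΩcv hpara.1 hc hx hy
  have hcomp : IsCompact (Metric.closedBall y K ∩ Ω) :=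
    (isCompact_closedBall y K).inter_right hΩcl
  have hmem : ∀ t, t₀ + 1 < t → x t ∈ Metric.closedBall y K ∩ Ω := fun t ht =>
    ⟨by simpa [dist_eq_norm] using hK t ht, hx.mem t (by linarith)⟩
  -- A bound on `U` along the trajectory keeps the normalisation `max 1 ‖U (x t)‖` from spoiling the
  -- `1 / (t + 1)` rate.
  obtain ⟨C, hC⟩ := hcomp.exists_bound_of_continuousOn (hU.mono inter_subset_right)
  obtain ⟨L', hL⟩ := exists_hasDerivAt_lyapunov hΩcl hΩcv hc hx hy.1
  have hM : 0 < max 1 C := lt_max_of_lt_left one_pos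
  have hfreq : ∀ ε > 0, ∃ᶠ t in atTop, inner ℝ (U (x t)) (x t - y) < ε := fun ε hε => by
    refine frequently_lt_of_deriv_le (t₀ := t₀ + 1) (c := 1 / max 1 C)
      (by linarith [hc.t₀_nonneg]) (by positivity) (fun t ht => (hL t (by linarith)).1)
      (fun t ht => lyapunov_nonneg hc y (by linarith))
      (fun t ht => (hL t (by linarith)).2.trans (neg_le_neg ?_)) hε
    have ht' : t₀ < t := by linarith
    have h1 := hy.inner_nonneg hpara.1 (hx.mem t ht')
    have h2 := hc.le_delta_mul_step t ht'
    have h3 : max 1 ‖U (x t)‖ ≤ max 1 C := max_le_max le_rfl (hC _ (hmem t ht))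
    have h4 : 0 ≤ δ t * α₀ t := mul_nonneg (hc.delta_nonneg t ht') (hc.step_nonneg t ht')
    calc 1 / max 1 C * inner ℝ (U (x t)) (x t - y) / (t + 1)
        = 1 / (t + 1) / max 1 C * inner ℝ (U (x t)) (x t - y) := by ring
      _ ≤ δ t * α₀ t / max 1 ‖U (x t)‖ * inner ℝ (U (x t)) (x t - y) := by gcongr
      _ = _ := by ring
  have hseq : ∀ n : ℕ, ∃ t, max (n : ℝ) (t₀ + 2) ≤ t ∧
      inner ℝ (U (x t)) (x t - y) < 1 / ((n : ℝ) + 1) := fun n =>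
    (((hfreq _ (by positivity)).and_eventually (eventually_ge_atTop _)).exists).imp
      fun t ht => ⟨ht.2, ht.1⟩
  choose τ hτ hτw using hseq
  have hτ0 : ∀ n, t₀ + 1 < τ n := fun n => by linarith [(le_max_right _ _).trans (hτ n)]
  have hτlim : Tendsto τ atTop atTop :=
    tendsto_atTop_mono (fun n => (le_max_left _ _).trans (hτ n)) tendsto_natCast_atTop_atTop
  obtain ⟨z, hz, φ, hφ, hlim⟩ := hcomp.tendsto_subseq fun n => hmem (τ n) (hτ0 n)
  have hUlim : Tendsto (fun n => U (x (τ (φ n)))) atTop (𝓝 (U z)) :=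
    (hU z hz.2).tendsto.comp (tendsto_nhdsWithin_iff.2
      ⟨hlim, Eventually.of_forall fun n => (hmem _ (hτ0 (φ n))).2⟩)
  have hle : inner ℝ (U z) (z - y) ≤ 0 :=
    le_of_tendsto_of_tendsto' (hUlim.inner (hlim.sub_const y))
      (tendsto_one_div_add_atTop_nhds_zero_nat.comp hφ.tendsto_atTop) fun n => (hτw (φ n)).le
  exact ⟨z, τ ∘ φ, hy.of_inner_nonpos hpara hz.2 hle, hτlim.comp hφ.tendsto_atTop, hlim⟩

theorem IsClassicalTrajectory.exists_tendsto_solution (hΩcl : IsClosed Ω) (hΩcv : Convex ℝ Ω)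
    (hpara : ParamonotoneOpOn Ω U) (hU : ContinuousOn U Ω) (hsol : ∃ y, IsVISolution Ω U y)
    (hc : AdmissibleCoefficients α₀ α₁ δ α₁' μ h t₀)
    (hx : IsClassicalTrajectory Ω U α₀ α₁ δ t₀ x v) :
    ∃ z, IsVISolution Ω U z ∧ Tendsto x atTop (𝓝 z) := by
  obtain ⟨y, hy⟩ := hsol
  obtain ⟨z, τ, hz, hτ, hlim⟩ := exists_subseq_tendsto_solution hΩcl hΩcv hpara hU hc hx hy
  obtain ⟨l, hl⟩ := exists_tendsto_norm_sub_sq hΩcl hΩcv hpara.1 hc hx hz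
  have h1 : Tendsto (fun n => ‖x (τ n) - z‖ ^ 2) atTop (𝓝 0) := by
    simpa using ((hlim.sub_const z).norm).pow 2
  have h2 : l = 0 := tendsto_nhds_unique (hl.comp hτ) h1
  subst h2
  refine ⟨z, hz, tendsto_iff_norm_sub_tendsto_zero.2 ?_⟩
  simpa using hl.sqrt

end Convergence

/-! ### Admissibility of the power coefficients -/

section PowerCoefficients

theorem hasDerivAt_add_one_rpow {t : ℝ} (ht : 0 < t + 1) (r : ℝ) :
    HasDerivAt (fun u : ℝ => (u + 1) ^ r) (r * (t + 1) ^ (r - 1)) t := by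
  simpa using ((hasDerivAt_id t).add_const 1).rpow_const (p := r) (Or.inl ht.ne')

theorem tendsto_add_one_rpow_neg {r : ℝ} (hr : 0 < r) :
    Tendsto (fun t : ℝ => (t + 1) ^ (-r)) atTop (𝓝 0) :=
  (tendsto_rpow_neg_atTop hr).comp (tendsto_atTop_add_const_right _ 1 tendsto_id)

theorem one_div_add_one_rpow_le_one {t r : ℝ} (ht : 0 ≤ t) (hr : 0 ≤ r) :
    1 / (t + 1) ^ r ≤ 1 := by
  have h1 : 1 ≤ (t + 1) ^ r := Real.one_le_rpow (by linarith) hr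
  rw [div_le_one (by linarith)]
  exact h1

theorem admissibleCoefficients_rpow {h s p q t₀ : ℝ} (hh : 2 ≤ h) (hs₀ : 0 < s) (hp₀ : 0 ≤ p)
    (hq₀ : 0 < q) (hpq : 1 < p + 2 * q) (hpq' : p + q ≤ 1) (ht₀ : 0 ≤ t₀) :
    AdmissibleCoefficients (fun t => 1 / (t + 1) ^ q) (fun t => h + 1 / (t + 1) ^ s)
      (fun t => 1 / (t + 1) ^ p) (fun t => -s * (t + 1) ^ (-s - 1))
      (fun t => (t + 1) ^ (1 - (p + 2 * q)) / (p + 2 * q - 1)) h t₀ := by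
  have hpos : ∀ t, t₀ < t → 0 < t + 1 := fun t ht => by linarith
  have heq : ∀ r : ℝ, (fun t : ℝ => 1 / (t + 1) ^ r) =ᶠ[atTop] fun t => (t + 1) ^ (-r) := by
    intro r
    filter_upwards [eventually_gt_atTop t₀] with t ht
    rw [Real.rpow_neg (hpos t ht).le, one_div]
  have hprod : ∀ t, t₀ < t → 1 / (t + 1) ^ p * (1 / (t + 1) ^ q) = (t + 1) ^ (-(p + q)) := by
    intro t ht
    rw [Real.rpow_neg (hpos t ht).le, Real.rpow_add (hpos t ht)]
    field_simp
  refine ⟨ht₀, hh, fun t ht => ?_, fun t ht => ?_, fun t ht => ?_, ?_, fun t ht => ?_,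
    fun t ht => ?_, fun t ht => ?_, fun t ht => ?_, fun t ht => ?_, fun t ht => ?_, ?_⟩
  · have := hpos t ht
    have : 0 < 1 / (t + 1) ^ s := by positivity
    linarith
  · refine ((hasDerivAt_add_one_rpow (hpos t ht) (-s)).const_add h).congr_of_eventuallyEq ?_
    filter_upwards [Ioi_mem_nhds ht] with u hu
    rw [Real.rpow_neg (hpos u hu).le, one_div]
  · have := hpos t ht
    have : 0 < s * (t + 1) ^ (-s - 1) := by positivity
    linarith
  · simpa using ((tendsto_add_one_rpow_neg hs₀).congr' (heq s).symm).const_add h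
  · have := hpos t ht
    positivity
  · exact one_div_add_one_rpow_le_one (ht₀.trans ht.le) hp₀
  · have := hpos t ht
    positivity
  · have h1 := (hasDerivAt_add_one_rpow (hpos t ht) (1 - (p + 2 * q))).div_const (p + 2 * q - 1)
    refine h1.congr_deriv ?_
    have h2 : 1 / (t + 1) ^ p * (1 / (t + 1) ^ q) ^ 2 = (t + 1) ^ (1 - (p + 2 * q) - 1) := by
      rw [show 1 - (p + 2 * q) - 1 = -(p + (q + q)) by ring, Real.rpow_neg (hpos t ht).le,
        Real.rpow_add (hpos t ht), Real.rpow_add (hpos t ht)]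
      field_simp
    rw [h2]
    have h3 : p + 2 * q - 1 ≠ 0 := by linarith
    field_simp
    ring
  · have := hpos t ht
    have : 0 < p + 2 * q - 1 := by linarith
    positivity
  · rw [hprod t ht, one_div, ← Real.rpow_neg_one]
    exact Real.rpow_le_rpow_of_exponent_le (by linarith) (by linarith)
  · refine (tendsto_add_one_rpow_neg (by linarith : 0 < p + q)).congr' ?_
    filter_upwards [eventually_gt_atTop t₀] with t ht using (hprod t ht).symm

end PowerCoefficients

/-- A strong solution staying in `Ω` solves the equation classically. -/
theorem IsStrongGlobalSolution.isClassicalTrajectory {d : ℕ} {Ω : Set (EuclideanSpace ℝ (Fin d))}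
    {U : EuclideanSpace ℝ (Fin d) → EuclideanSpace ℝ (Fin d)} {α₀ α₁ δ : ℝ → ℝ} {t₀ : ℝ}
    {x₀ x₁ : EuclideanSpace ℝ (Fin d)} {x : ℝ → EuclideanSpace ℝ (Fin d)}
    (hΩcl : IsClosed Ω) (hΩcv : Convex ℝ Ω) (hU : ContinuousOn U Ω)
    (hα₀ : ContinuousOn α₀ (Ici t₀)) (hα₁ : ContinuousOn α₁ (Ici t₀))
    (hδ : ContinuousOn δ (Ici t₀))
    (hx : IsStrongGlobalSolution Ω U α₀ α₁ δ (fun _ => 0) t₀ x₀ x₁ x)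
    (hmem : ∀ t, t₀ ≤ t → x t ∈ Ω) :
    IsClassicalTrajectory Ω U α₀ α₁ δ t₀ x (velocity t₀ x) := by
  refine ⟨fun t ht => hmem t ht.le, fun t ht =>
    (hx.differentiableOn t ht.le).hasDerivWithinAt.hasDerivAt (Ici_mem_nhds ht), fun t ht => ?_⟩
  have hv : ContinuousOn (velocity t₀ x) (Ici t₀) := by
    intro u hu
    have h1 := (hx.locallyAC_velocity (u + 1) (by linarith [mem_Ici.1 hu])).continuousOn
    rw [uIcc_of_le (by linarith [mem_Ici.1 hu])] at h1
    refine (h1 u ⟨hu, by linarith⟩).mono_of_mem_nhdsWithin ?_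
    rw [← Ici_inter_Iic]
    exact inter_mem self_mem_nhdsWithin (mem_nhdsWithin_of_mem_nhds (Iic_mem_nhds (lt_add_one u)))
  have hg := ((hα₁.fun_smul hv).fun_neg).fun_add (hδ.fun_smul
    ((continuousOn_projStep_comp ⟨x t₀, hmem t₀ le_rfl⟩ hΩcl hΩcv hU
      hx.differentiableOn.continuousOn hmem hα₀).fun_sub hx.differentiableOn.continuousOn))
  refine hasDerivAt_of_ae_of_continuousOn hx.locallyAC_velocity hg ?_ ht
  filter_upwards [hx.equation] with u hu hlt
  obtain ⟨x'', hx'', heq⟩ := hu hlt.le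
  rw [zero_smul, add_zero] at heq
  have h1 := hx''.hasDerivAt (Ici_mem_nhds hlt)
  rwa [eq_neg_add_of_add_eq (a := x'') ((add_comm _ _).trans heq)] at h1

end ParamonotoneVI

open ParamonotoneVI in
theorem mainTheorem6 (d : ℕ) (Ω : Set (EuclideanSpace ℝ (Fin d)))
    (hΩne : Ω.Nonempty) (hΩcl : IsClosed Ω) (hΩcv : Convex ℝ Ω)
    (U : EuclideanSpace ℝ (Fin d) → EuclideanSpace ℝ (Fin d))
    (hUpara : ParamonotoneVI.ParamonotoneOpOn Ω U) (hUcont : ContinuousOn U Ω)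
    (hsol : ∃ x, ParamonotoneVI.IsVISolution Ω U x)
    (h s p q : ℝ) (hh : 2 < h) (hs₀ : 0 < s) (hs₁ : s < 1 / 2) (hsp : s < p) (hp : p < 1)
    (hq₀ : (1 - p) / 2 < q) (hq₁ : q ≤ 1 - p)
    (t₀ : ℝ) (ht₀ : 0 ≤ t₀)
    (x₀ x₁ : EuclideanSpace ℝ (Fin d)) (hx₀ : x₀ ∈ Ω) (hx₁ : x₁ ∈ Ω)
    (x : ℝ → EuclideanSpace ℝ (Fin d))
    (hx : ParamonotoneVI.IsStrongGlobalSolution Ω U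
      (fun t => 1 / (t + 1) ^ q) (fun t => h + 1 / (t + 1) ^ s)
      (fun t => 1 / (t + 1) ^ p) (fun _ => 0) t₀ x₀ x₁ x) :
    ∃ xstar, ParamonotoneVI.IsVISolution Ω U xstar ∧ Tendsto x atTop (𝓝 xstar) := by
  have hcont : ∀ r : ℝ, ContinuousOn (fun t : ℝ => 1 / (t + 1) ^ r) (Ici t₀) := fun r t ht => by
    have h1 : 0 < t + 1 := by linarith [mem_Ici.1 ht]
    exact (continuousAt_const.div (hasDerivAt_add_one_rpow h1 r).continuousAt
      (Real.rpow_pos_of_pos h1 r).ne').continuousWithinAt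
  have hle : ∀ r : ℝ, 0 ≤ r → ∀ t, t₀ ≤ t → 0 ≤ 1 / (t + 1) ^ r ∧ 1 / (t + 1) ^ r ≤ 1 :=
    fun r hr t ht => by
      have h1 : 0 < t + 1 := by linarith
      exact ⟨by positivity, one_div_add_one_rpow_le_one (ht₀.trans ht) hr⟩
  have hmem : ∀ t, t₀ ≤ t → x t ∈ Ω := fun t ht =>
    -- The choice `a = h / 2` maximises `a (h - a)`, giving `h² / 4 > 1 ≥ δ`; also `α₁ t₀ ≤ h + 1 ≤
    -- 2h = 4a`, and `α₁ - a ≤ h / 2 + 1`.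
    hx.mem hΩcl hΩcv hx₀ hx₁ (a := h / 2) (β := h / 2 + 1)
      (fun u hu => by linarith [(hle s hs₀.le u hu).2])
      (fun u hu => (hle p (by linarith) u hu).1)
      (fun u hu => by
        have h1 := (hle p (by linarith) u hu).2
        have h2 := (hle s hs₀.le u hu).1
        nlinarith)
      (by linarith [(hle s hs₀.le t₀ le_rfl).1]) (by linarith [(hle s hs₀.le t₀ le_rfl).2]) ht
  exact (hx.isClassicalTrajectory hΩcl hΩcv hUcont (hcont q) (continuousOn_const.add (hcont s))
    (hcont p) hmem).exists_tendsto_solution hΩcl hΩcv hUpara hUcont hsol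
    (admissibleCoefficients_rpow hh.le hs₀ (by linarith) (by linarith) (by linarith)
      (by linarith) ht₀)
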